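/- Let $\mathcal X=\{1,2,\dots\}$. For a probability distribution $P$ on $\mathcal X$ let $P^{\downarrow}(1)\ge P^{\downarrow}(2)\ge\cdots$ be its masses listed in decreasing order (with multiplicity, and continued by zeros if $P$ has only finitely many positive masses), and let $H(P)=-\sum_{x} P(x)\log P(x)\in[0,\infty]$ be its Shannon entropy (natural logarithm, $0\log 0=0$). A distribution $Q$ majorizes $P$ if $\sum_{i=1}^{k}P^{\downarrow}(i)\le\sum_{i=1}^{k}Q^{\downarrow}(i)$ for every $k\ge 1$. For a random variable $X$ with values in a countable set and a random variable $Y$ with values in a measurable space $\mathcal Y$, let $H(X\mid Y)=\mathbb E[H(P_{X|Y})]$, where $P_{X|Y}$ is the regular conditional distribution of $X$ given $Y$. If $X$ is $\mathcal X$-valued and $L\ge 1$ is an integer, let $$P_{\mathrm e}^{(L)}(X\mid Y)=\inf_{f}\ \mathbb P\{X\notin f(Y)\},$$ where $f$ ranges over all measurable maps that assign to each $y\in\mathcal Y$ a nonempty subset $f(y)\subset\mathcal X$ with at most $L$ elements. Let $\{L_n\}_{n\ge1}$ be a sequence of positive integers, $\{\mathcal Y_n\}_{n\ge1}$ a sequence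 of measurable spaces, and $\{(X_n,Y_n)\}_{n\ge1}$ a sequence of random variables on a common probability space, where $(X_n,Y_n)$ is $\mathcal X\times\mathcal Y_n$-valued and $H(P_{X_n})<\infty$ for every $n\ge1$. (No independence is assumed.) Write $X^n=(X_1,\dots,X_n)$ and $Y^n=(Y_1,\dots,Y_n)$. Let $P_X$ be a probability distribution on $\mathcal X$ with $H(P_X)<\infty$. **Theorem.** Suppose that $P_{X_n}$ majorizes $P_X$ for all sufficiently large $n$. If $$\lim_{n\to\infty}\frac1n\sum_{i=1}^{n}P_{\mathrm e}^{(L_n)}(X_i\mid Y_i)=0,$$ then $$\limsup_{n\to\infty}\frac1n H(X^n\mid Y^n)\ \le\ \limsup_{n\to\infty}\log L_n ,$$ where both sides are elements of $[0,\infty]$. -/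

import Mathlib

open MeasureTheory ProbabilityTheory Filter Topology
open scoped ENNReal

/-! The source alphabet is `ℕ`, i.e. the countably infinite alphabet `{1, 2, …}` with its letters
relabelled by `x ↦ x - 1`. A distribution on the alphabet is a probability measure on `ℕ`. -/

/-- The decreasing rearrangement of a distribution `P` on `ℕ`: `decRearr P k` is the
`(k+1)`-st largest probability mass of `P`, counted with multiplicity; in the usual form,
`P↓ (k) = inf {t ≥ 0 : at most k letters have mass exceeding t}`. -/
noncomputable def decRearr (P : Measure ℕ) (k : ℕ) : ℝ≥0∞ :=
  sInf {t : ℝ≥0∞ | {x : ℕ | t < P {x}}.encard ≤ k}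

/-- `Majorizes Q P`: the distribution `Q` majorizes the distribution `P`. -/
def Majorizes (Q P : Measure ℕ) : Prop :=
  ∀ k : ℕ, ∑ i ∈ Finset.range k, decRearr P i ≤ ∑ i ∈ Finset.range k, decRearr Q i

/-- Shannon entropy (natural logarithm, with `0 log 0 = 0`) of a distribution on a countable
alphabet, with values in `[0, ∞]`. -/
noncomputable def shannonEntropy {α : Type*} [Countable α] [MeasurableSpace α] (P : Measure α) : ℝ≥0∞ :=
  ∑' x : α, ENNReal.ofReal (Real.negMulLog (P.real {x}))

/-- Conditional Shannon entropy `H(X | Y) = 𝔼[H(P_{X|Y})]`, where `P_{X|Y}` is the regular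
conditional distribution of `X` given `Y`. -/
noncomputable def condShannonEntropy {Ω α β : Type*} [MeasurableSpace Ω]
    [Countable α] [MeasurableSpace α] [StandardBorelSpace α] [Nonempty α] [MeasurableSpace β]
    (X : Ω → α) (Y : Ω → β) (μ : Measure Ω) [IsFiniteMeasure μ] : ℝ≥0∞ :=
  ∫⁻ ω, shannonEntropy (condDistrib X Y μ (Y ω)) ∂μ

/-- A list decoder with list size `L`: a measurable map that assigns to each observation `y`
a nonempty list of at most `L` letters. -/
structure ListDecoder (β : Type*) [MeasurableSpace β] (L : ℕ) where
  /-- the list of candidates -/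
  toFun : β → Finset ℕ
  nonempty : ∀ y, (toFun y).Nonempty
  card_le : ∀ y, (toFun y).card ≤ L
  measurableSet_mem : ∀ x, MeasurableSet {y | x ∈ toFun y}

/-- The minimum average probability of error under list decoding, `P_e^{(L)}(X | Y)`. -/
noncomputable def listError {Ω β : Type*} [MeasurableSpace Ω] [MeasurableSpace β]
    (L : ℕ) (X : Ω → ℕ) (Y : Ω → β) (μ : Measure Ω) : ℝ≥0∞ :=
  ⨅ f : ListDecoder β L, μ {ω | X ω ∉ f.toFun (Y ω)}

/-- The block `(Z_1, …, Z_n)`, where `Z i` stands for `Z_{i+1}`. -/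
def block {Ω : Type*} {β : ℕ → Type*} (Z : (i : ℕ) → Ω → β i) (n : ℕ) :
    Ω → ((i : Fin n) → β i) :=
  fun ω i => Z i ω

/-- The minimum arithmetic-mean probability of symbol-wise list decoding error
`(1/n) ∑_{i=1}^n P_e^{(L_n)}(X_i | Y_i)`, where `X i`, `Y i` stand for `X_{i+1}`, `Y_{i+1}`
and `L n` is the list size used for blocks of length `n`. -/
noncomputable def symbolwiseListError {Ω : Type*} [MeasurableSpace Ω] {β : ℕ → Type*}
    [∀ i, MeasurableSpace (β i)] (L : ℕ → ℕ) (X : ℕ → Ω → ℕ) (Y : (i : ℕ) → Ω → β i)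
    (μ : Measure Ω) (n : ℕ) : ℝ≥0∞ :=
  (∑ i ∈ Finset.range n, listError (L n) (X i) (Y i) μ) / (n : ℝ≥0∞)

/-!
Gibbs' inequality bounds `H(X | Y)` by the mean self-information of `X` under any sub-probability
kernel `q`. Products of conditional distributions give `H(Xⁿ | Yⁿ) ≤ ∑ H(Xᵢ | Yᵢ)`. For a single
pair, let `q` be a mixture of weight `w` on the decoded list, spread evenly, and weight `v = 1 - w`
on the law `P_X` of `X` itself. When decoding succeeds the cost is at most `-log w + log L`. When it
fails the cost is at most `-log v - log P_X(X)`; cutting the last term off at `M` gives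
  `H(X | Y) ≤ -log w + log L + E[(-log P_X(X) - M)⁺] + P_e (-log v + M)`.

The expectation is uniformly small over all laws `Q` that majorize a law `P` of finite entropy: it
is at most `∫_M^∞ ∑ₓ min (Q x) e^{-s} ds`, the sum `∑ₓ min (Q x) c = 1 - ∑ₓ (Q x - c)⁺` only grows
when `Q` is replaced by `P`, and for `P` the integral over `(0, ∞)` is at most `H(P) + 1`, so its
tails vanish. Hence `H(X | Y) ≤ log L + ε + C P_e` with `C` depending only on `P` and `ε`. This is
linear in `P_e`, so it averages over the letters of the block, and the finitely many letters whose
law does not majorize `P` contribute `O(1/n)`.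
-/

/-! ### Self-information and entropy -/

/-- The self-information `-log t` of a probability `t`, with value `∞` at `t = 0`. On `t ≥ 1` the
truncation `EReal.toENNReal` makes it `0`. -/
noncomputable def selfInfo (t : ℝ≥0∞) : ℝ≥0∞ :=
  (-ENNReal.log t).toENNReal

@[simp] lemma selfInfo_zero : selfInfo 0 = ∞ := by simp [selfInfo]

lemma measurable_selfInfo : Measurable selfInfo := by
  unfold selfInfo
  fun_prop

lemma antitone_selfInfo : Antitone selfInfo := fun _ _ hst =>
  EReal.toENNReal_le_toENNReal (EReal.neg_le_neg_iff.2 (ENNReal.log_monotone hst))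

lemma selfInfo_of_ne_zero {t : ℝ≥0∞} (ht : t ≠ 0) :
    selfInfo t = ENNReal.ofReal (-Real.log t.toReal) := by
  rcases eq_or_ne t ∞ with rfl | ht'
  · simp [selfInfo]
  · rw [selfInfo, ENNReal.log_pos_real ht ht', ← EReal.coe_neg, EReal.toENNReal_of_ne_top
      (EReal.coe_ne_top _), EReal.toReal_coe]

lemma selfInfo_ne_top {t : ℝ≥0∞} (ht : t ≠ 0) : selfInfo t ≠ ∞ := by
  rw [selfInfo_of_ne_zero ht]
  exact ENNReal.ofReal_ne_top

lemma selfInfo_ofReal_exp_neg (h : ℝ) :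
    selfInfo (ENNReal.ofReal (Real.exp (-h))) = ENNReal.ofReal h := by
  rw [selfInfo, ENNReal.log_ofReal_of_pos (Real.exp_pos _), Real.log_exp, ← EReal.coe_neg, neg_neg,
    EReal.toENNReal_of_ne_top (EReal.coe_ne_top _), EReal.toReal_coe]

lemma selfInfo_natCast_inv (n : ℕ) :
    selfInfo (n : ℝ≥0∞)⁻¹ = ENNReal.ofReal (Real.log n) := by
  rw [selfInfo_of_ne_zero (by simp), ENNReal.toReal_inv, Real.log_inv, neg_neg,
    ENNReal.toReal_natCast]

lemma selfInfo_mul_le (s t : ℝ≥0∞) : selfInfo (s * t) ≤ selfInfo s + selfInfo t := by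
  rcases eq_or_ne s 0 with rfl | hs
  · simp
  rcases eq_or_ne t 0 with rfl | ht
  · simp
  rw [selfInfo, ENNReal.log_mul_add, EReal.neg_add (by simp [hs]) (by simp [ht])]
  exact EReal.toENNReal_add_le

lemma selfInfo_prod_le {ι : Type*} (s : Finset ι) (f : ι → ℝ≥0∞) :
    selfInfo (∏ i ∈ s, f i) ≤ ∑ i ∈ s, selfInfo (f i) := by
  classical
  induction s using Finset.induction_on with
  | empty => simp [selfInfo]
  | insert a s ha ih =>
    rw [Finset.prod_insert ha, Finset.sum_insert ha]
    exact (selfInfo_mul_le _ _).trans (by gcongr)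

lemma exists_eq_ofReal_exp_neg {p : ℝ≥0∞} (hp₀ : p ≠ 0) (hp : p ≠ ∞) :
    ∃ h : ℝ, p = ENNReal.ofReal (Real.exp (-h)) :=
  ⟨-Real.log p.toReal, by
    rw [neg_neg, Real.exp_log (ENNReal.toReal_pos hp₀ hp), ENNReal.ofReal_toReal hp]⟩

lemma ofReal_negMulLog_toReal {p : ℝ≥0∞} (hp : p ≠ ∞) :
    ENNReal.ofReal (Real.negMulLog p.toReal) = p * selfInfo p := by
  rcases eq_or_ne p 0 with rfl | hp₀
  · simp
  rw [selfInfo_of_ne_zero hp₀, Real.negMulLog, neg_mul_comm,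
    ENNReal.ofReal_mul ENNReal.toReal_nonneg, ENNReal.ofReal_toReal hp]

lemma mul_selfInfo_add_le {p q : ℝ≥0∞} (hp : p ≤ 1) (hq : q ≤ 1) :
    p * selfInfo p + p ≤ p * selfInfo q + q := by
  rcases eq_or_ne p 0 with rfl | hp₀
  · simp
  rcases eq_or_ne q 0 with rfl | hq₀
  · simp [ENNReal.mul_top hp₀]
  obtain ⟨a, rfl⟩ := exists_eq_ofReal_exp_neg hp₀ (ne_top_of_le_ne_top ENNReal.one_ne_top hp)
  obtain ⟨b, rfl⟩ := exists_eq_ofReal_exp_neg hq₀ (ne_top_of_le_ne_top ENNReal.one_ne_top hq)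
  have ha : 0 ≤ a := by simpa using hp
  have hb : 0 ≤ b := by simpa using hq
  have hexp : Real.exp (-b) = Real.exp (-a) * Real.exp (a - b) := by
    rw [← Real.exp_add]; ring_nf
  rw [selfInfo_ofReal_exp_neg, selfInfo_ofReal_exp_neg, ← ENNReal.ofReal_mul (by positivity),
    ← ENNReal.ofReal_mul (by positivity), ← ENNReal.ofReal_add (by positivity) (by positivity),
    ← ENNReal.ofReal_add (by positivity) (by positivity), hexp]
  refine ENNReal.ofReal_le_ofReal ?_
  nlinarith [Real.add_one_le_exp (a - b), Real.exp_pos (-a)]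

section Entropy

variable {α : Type*} [Countable α] [MeasurableSpace α]

lemma shannonEntropy_eq_tsum (P : Measure α) [IsFiniteMeasure P] :
    shannonEntropy P = ∑' x, P {x} * selfInfo (P {x}) :=
  tsum_congr fun _ => ofReal_negMulLog_toReal (measure_ne_top P _)

variable [MeasurableSingletonClass α]

lemma tsum_measure_singleton (P : Measure α) : ∑' x, P {x} = P Set.univ := by
  simpa using P.tsum_indicator_apply_singleton Set.univ MeasurableSet.univ

lemma shannonEntropy_le_tsum_mul_selfInfo (P : Measure α) [IsProbabilityMeasure P] {q : α → ℝ≥0∞}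
    (hq : ∑' x, q x ≤ 1) : shannonEntropy P ≤ ∑' x, P {x} * selfInfo (q x) := by
  have hP : ∑' x, P {x} = 1 := by rw [tsum_measure_singleton, measure_univ]
  refine (ENNReal.add_le_add_iff_right ENNReal.one_ne_top).mp ?_
  calc shannonEntropy P + 1
      = ∑' x, (P {x} * selfInfo (P {x}) + P {x}) := by
        rw [ENNReal.tsum_add, hP, shannonEntropy_eq_tsum]
    _ ≤ ∑' x, (P {x} * selfInfo (q x) + q x) := ENNReal.tsum_le_tsum fun x =>
        mul_selfInfo_add_le prob_le_one ((ENNReal.le_tsum x).trans hq)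
    _ ≤ ∑' x, P {x} * selfInfo (q x) + 1 := by rw [ENNReal.tsum_add]; gcongr

lemma lintegral_comp_eq_tsum {Ω : Type*} [MeasurableSpace Ω] {μ : Measure Ω} {X : Ω → α}
    (hX : Measurable X) (F : α → ℝ≥0∞) : ∫⁻ ω, F (X ω) ∂μ = ∑' x, μ.map X {x} * F x := by
  rw [← lintegral_map (measurable_of_countable F) hX, lintegral_countable']
  exact tsum_congr fun _ => mul_comm _ _

end Entropy

section CondEntropy

variable {Ω α β : Type*} [MeasurableSpace Ω] [Countable α] [MeasurableSpace α]
  [StandardBorelSpace α] [Nonempty α] [MeasurableSpace β] {X : Ω → α} {Y : Ω → β} {μ : Measure Ω}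

lemma measurable_condDistrib_singleton [IsFiniteMeasure μ] :
    Measurable fun z : β × α => condDistrib X Y μ z.1 {z.2} :=
  measurable_from_prod_countable_left fun _ =>
    Kernel.measurable_coe _ (measurableSet_singleton _)

lemma lintegral_tsum_condDistrib_mul [IsFiniteMeasure μ] (hX : Measurable X) (hY : Measurable Y)
    {F : β × α → ℝ≥0∞} (hF : Measurable F) :
    ∫⁻ ω, ∑' x, condDistrib X Y μ (Y ω) {x} * F (Y ω, x) ∂μ = ∫⁻ ω, F (Y ω, X ω) ∂μ := by
  calc ∫⁻ ω, ∑' x, condDistrib X Y μ (Y ω) {x} * F (Y ω, x) ∂μ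
      = ∫⁻ ω, ∫⁻ x, F (Y ω, x) ∂(condDistrib X Y μ (Y ω)) ∂μ := by
        simp only [lintegral_countable', mul_comm]
    _ = ∫⁻ z, F z ∂(μ.map Y ⊗ₘ condDistrib X Y μ) := by
        rw [Measure.lintegral_compProd hF, lintegral_map hF.lintegral_kernel_prod_right' hY]
    _ = ∫⁻ ω, F (Y ω, X ω) ∂μ := by
        rw [compProd_map_condDistrib hX.aemeasurable, lintegral_map hF (hY.prodMk hX)]

lemma condShannonEntropy_eq_lintegral_selfInfo [IsFiniteMeasure μ] (hX : Measurable X)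
    (hY : Measurable Y) :
    condShannonEntropy X Y μ = ∫⁻ ω, selfInfo (condDistrib X Y μ (Y ω) {X ω}) ∂μ := by
  refine (lintegral_congr fun _ => shannonEntropy_eq_tsum _).trans ?_
  exact lintegral_tsum_condDistrib_mul hX hY
    (measurable_selfInfo.comp measurable_condDistrib_singleton)

lemma condShannonEntropy_le_lintegral_selfInfo [IsFiniteMeasure μ] (hX : Measurable X)
    (hY : Measurable Y) {q : β × α → ℝ≥0∞} (hq : Measurable q) (hq₁ : ∀ y, ∑' x, q (y, x) ≤ 1) :
    condShannonEntropy X Y μ ≤ ∫⁻ ω, selfInfo (q (Y ω, X ω)) ∂μ := by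
  refine (lintegral_mono fun ω => shannonEntropy_le_tsum_mul_selfInfo _ (hq₁ (Y ω))).trans_eq ?_
  exact lintegral_tsum_condDistrib_mul hX hY (measurable_selfInfo.comp hq)

lemma condShannonEntropy_le_shannonEntropy [IsProbabilityMeasure μ] (hX : Measurable X)
    (hY : Measurable Y) : condShannonEntropy X Y μ ≤ shannonEntropy (μ.map X) := by
  have := Measure.isProbabilityMeasure_map (μ := μ) hX.aemeasurable
  have hq : Measurable fun z : β × α => μ.map X {z.2} :=
    (measurable_of_countable fun x : α => μ.map X {x}).comp measurable_snd
  refine (condShannonEntropy_le_lintegral_selfInfo hX hY hq fun _ => ?_).trans_eq ?_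
  · rw [tsum_measure_singleton, measure_univ]
  · rw [lintegral_comp_eq_tsum hX fun x => selfInfo (μ.map X {x}), shannonEntropy_eq_tsum]

end CondEntropy

lemma condShannonEntropy_pi_le_sum {Ω ι : Type*} [MeasurableSpace Ω] {μ : Measure Ω}
    [IsFiniteMeasure μ] [Fintype ι] {α β : ι → Type*} [∀ i, Countable (α i)]
    [∀ i, MeasurableSpace (α i)] [∀ i, StandardBorelSpace (α i)] [∀ i, Nonempty (α i)]
    [∀ i, MeasurableSpace (β i)] {X : (i : ι) → Ω → α i} {Y : (i : ι) → Ω → β i}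
    (hX : ∀ i, Measurable (X i)) (hY : ∀ i, Measurable (Y i)) :
    condShannonEntropy (fun ω i => X i ω) (fun ω i => Y i ω) μ
      ≤ ∑ i, condShannonEntropy (X i) (Y i) μ := by
  let κ (i : ι) (y : β i) : Measure (α i) := condDistrib (X i) (Y i) μ y
  have hκ : Measurable fun z : ((i : ι) → β i) × ((i : ι) → α i) => ∏ i, κ i (z.1 i) {z.2 i} :=
    Finset.measurable_fun_prod _ fun i _ => measurable_condDistrib_singleton.comp
      (((measurable_pi_apply i).comp measurable_fst).prodMk
        ((measurable_pi_apply i).comp measurable_snd))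
  have hκ₁ (y : (i : ι) → β i) : ∑' x : (i : ι) → α i, ∏ i, κ i (y i) {x i} ≤ 1 := by
    simp_rw [← Measure.pi_singleton, tsum_measure_singleton]
    exact prob_le_one
  calc condShannonEntropy (fun ω i => X i ω) (fun ω i => Y i ω) μ
      ≤ ∫⁻ ω, selfInfo (∏ i, κ i (Y i ω) {X i ω}) ∂μ :=
        condShannonEntropy_le_lintegral_selfInfo (measurable_pi_lambda _ hX)
          (measurable_pi_lambda _ hY) hκ hκ₁
    _ ≤ ∫⁻ ω, ∑ i, selfInfo (κ i (Y i ω) {X i ω}) ∂μ :=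
        lintegral_mono fun ω => selfInfo_prod_le _ _
    _ = ∑ i, condShannonEntropy (X i) (Y i) μ := by
        simp_rw [fun i => condShannonEntropy_eq_lintegral_selfInfo (μ := μ) (hX i) (hY i)]
        exact lintegral_finsetSum _ fun i _ => measurable_selfInfo.comp
          (measurable_condDistrib_singleton.comp ((hY i).prodMk (hX i)))


/-! ### The tail of the entropy -/

/-- The tail `∫_M^∞ ∑ₓ min (P x) e^{-s} ds` of the entropy of `P`. The sum over `x` is monotone
under majorization, and with `p = e^{-h}` the integral of `min p e^{-s}` over `s > M` is
`p (h - M) + p` for `h ≥ M`, so this quantity dominates the part of the entropy that is due to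
self-information in excess of `M`. -/
noncomputable def entropyTail {α : Type*} [MeasurableSpace α] (P : Measure α) (M : ℝ) : ℝ≥0∞ :=
  ∫⁻ s in Set.Ioi M, ∑' x, min (P {x}) (ENNReal.ofReal (Real.exp (-s)))

lemma measurable_min_exp_neg (p : ℝ≥0∞) :
    Measurable fun s : ℝ => min p (ENNReal.ofReal (Real.exp (-s))) := by
  fun_prop

lemma mul_selfInfo_tsub_le_lintegral_min {p : ℝ≥0∞} (hp : p ≠ ∞) {M : ℝ} (hM : 0 ≤ M) :
    p * (selfInfo p - ENNReal.ofReal M)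
      ≤ ∫⁻ s in Set.Ioi M, min p (ENNReal.ofReal (Real.exp (-s))) := by
  rcases eq_or_ne p 0 with rfl | hp₀
  · simp
  obtain ⟨h, rfl⟩ := exists_eq_ofReal_exp_neg hp₀ hp
  set p := ENNReal.ofReal (Real.exp (-h)) with hp_def
  have hmin : ∀ s ∈ Set.Ioc M h, p ≤ min p (ENNReal.ofReal (Real.exp (-s))) := fun s hs =>
    le_min le_rfl (ENNReal.ofReal_le_ofReal (Real.exp_le_exp.2 (neg_le_neg hs.2)))
  calc p * (selfInfo p - ENNReal.ofReal M) = ∫⁻ _ in Set.Ioc M h, p := by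
        rw [hp_def, selfInfo_ofReal_exp_neg, ← ENNReal.ofReal_sub h hM, setLIntegral_const,
          Real.volume_Ioc]
    _ ≤ ∫⁻ s in Set.Ioc M h, min p (ENNReal.ofReal (Real.exp (-s))) :=
        setLIntegral_mono (measurable_min_exp_neg p) hmin
    _ ≤ _ := lintegral_mono_set Set.Ioc_subset_Ioi_self

lemma setLIntegral_Ioi_exp_neg (h : ℝ) :
    ∫⁻ s in Set.Ioi h, ENNReal.ofReal (Real.exp (-s)) = ENNReal.ofReal (Real.exp (-h)) := by
  rw [← ofReal_integral_eq_lintegral_ofReal (integrableOn_exp_neg_Ioi h)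
    (ae_of_all _ fun s => (Real.exp_pos _).le), integral_exp_neg_Ioi]

lemma lintegral_min_le_mul_selfInfo_add {p : ℝ≥0∞} (hp : p ≠ ∞) :
    ∫⁻ s in Set.Ioi (0 : ℝ), min p (ENNReal.ofReal (Real.exp (-s))) ≤ p * selfInfo p + p := by
  rcases eq_or_ne p 0 with rfl | hp₀
  · simp
  obtain ⟨h, rfl⟩ := exists_eq_ofReal_exp_neg hp₀ hp
  set p := ENNReal.ofReal (Real.exp (-h)) with hp_def
  have hcover : Set.Ioi 0 ⊆ Set.Ioc 0 h ∪ Set.Ioi h := fun s hs =>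
    (le_or_gt s h).imp (fun hsh => ⟨hs, hsh⟩) id
  calc ∫⁻ s in Set.Ioi (0 : ℝ), min p (ENNReal.ofReal (Real.exp (-s)))
      ≤ ∫⁻ s in Set.Ioc 0 h ∪ Set.Ioi h, min p (ENNReal.ofReal (Real.exp (-s))) :=
        lintegral_mono_set hcover
    _ ≤ (∫⁻ s in Set.Ioc 0 h, min p (ENNReal.ofReal (Real.exp (-s))))
          + ∫⁻ s in Set.Ioi h, min p (ENNReal.ofReal (Real.exp (-s))) :=
        lintegral_union_le _ _ _
    _ ≤ (∫⁻ _ in Set.Ioc 0 h, p) + ∫⁻ s in Set.Ioi h, ENNReal.ofReal (Real.exp (-s)) :=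
        add_le_add (lintegral_mono fun _ => min_le_left _ _)
          (lintegral_mono fun _ => min_le_right _ _)
    _ = p * selfInfo p + p := by
        rw [setLIntegral_const, Real.volume_Ioc, sub_zero, setLIntegral_Ioi_exp_neg, hp_def,
          selfInfo_ofReal_exp_neg]

section EntropyTail

variable {α : Type*} [Countable α] [MeasurableSpace α]

lemma entropyTail_eq_tsum (P : Measure α) (M : ℝ) :
    entropyTail P M
      = ∑' x, ∫⁻ s in Set.Ioi M, min (P {x}) (ENNReal.ofReal (Real.exp (-s))) :=
  lintegral_tsum fun _ => (measurable_min_exp_neg _).aemeasurable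

variable (P : Measure α) [IsFiniteMeasure P]

lemma tsum_mul_selfInfo_tsub_le_entropyTail {M : ℝ} (hM : 0 ≤ M) :
    ∑' x, P {x} * (selfInfo (P {x}) - ENNReal.ofReal M) ≤ entropyTail P M := by
  rw [entropyTail_eq_tsum]
  exact ENNReal.tsum_le_tsum fun _ => mul_selfInfo_tsub_le_lintegral_min (measure_ne_top P _) hM

variable [MeasurableSingletonClass α]

lemma entropyTail_zero_le : entropyTail P 0 ≤ shannonEntropy P + P Set.univ := by
  rw [entropyTail_eq_tsum, shannonEntropy_eq_tsum, ← tsum_measure_singleton, ← ENNReal.tsum_add]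
  exact ENNReal.tsum_le_tsum fun _ => lintegral_min_le_mul_selfInfo_add (measure_ne_top P _)

variable {P} in
lemma tendsto_entropyTail (hP : shannonEntropy P < ∞) :
    Tendsto (entropyTail P) atTop (𝓝 0) := by
  let ν : Measure ℝ := volume.withDensity fun s =>
    ∑' x, min (P {x}) (ENNReal.ofReal (Real.exp (-s)))
  have hν : entropyTail P = fun M => ν (Set.Ioi M) := funext fun M =>
    (withDensity_apply _ measurableSet_Ioi).symm
  have hfin : ν (Set.Ioi 0) ≠ ∞ := by
    rw [← congrFun hν]
    exact ((entropyTail_zero_le P).trans_lt (by finiteness)).ne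
  have hempty : ⋂ M : ℝ, Set.Ioi M = ∅ := by
    ext s
    simpa using ⟨s, le_rfl⟩
  rw [hν, ← measure_empty (μ := ν), ← hempty]
  exact tendsto_measure_iInter_atTop (fun _ => measurableSet_Ioi.nullMeasurableSet)
    antitone_Ioi ⟨0, hfin⟩

end EntropyTail

/-! ### Majorization -/

section Majorization

lemma lt_decRearr_iff {P : Measure ℕ} {k : ℕ} {t : ℝ≥0∞} :
    t < decRearr P k ↔ k < {x : ℕ | t < P {x}}.encard := by
  refine ⟨fun ht => not_le.1 fun hk => ht.not_ge (sInf_le hk), fun hk => ?_⟩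
  obtain ⟨S, hSt, hScard⟩ := Set.exists_subset_encard_eq (Order.add_one_le_of_lt hk)
  have hSfin : S.Finite := Set.finite_of_encard_eq_coe (k := k + 1) (by exact_mod_cast hScard)
  have hSne : S.Nonempty := by
    rw [← Set.one_le_encard_iff_nonempty, hScard]
    exact le_add_self
  obtain ⟨x, hxS, hx⟩ := hSfin.exists_minimalFor (fun x => P {x}) S hSne
  refine (hSt hxS).trans_le
    (le_sInf fun u (hu : {y | u < P {y}}.encard ≤ k) => not_lt.1 fun hux => ?_)
  have hSu : S ⊆ {y | u < P {y}} := fun y hy =>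
    hux.trans_le ((le_total _ _).elim id fun hyx => hx hy hyx)
  have hle : (k : ℕ∞) + 1 ≤ k := hScard.symm.trans_le ((Set.encard_le_encard hSu).trans hu)
  exact absurd hle (by exact_mod_cast k.lt_irrefl)

lemma decRearr_ne_top (P : Measure ℕ) [IsFiniteMeasure P] (k : ℕ) : decRearr P k ≠ ∞ := by
  refine ne_top_of_le_ne_top (measure_ne_top P Set.univ) (not_lt.1 fun h => ?_)
  obtain ⟨x, hx⟩ := Set.one_le_encard_iff_nonempty.1
    (Order.one_le_iff_pos.2 (zero_le.trans_lt (lt_decRearr_iff.1 h)))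
  exact hx.not_ge (measure_mono (Set.subset_univ _))

lemma antitone_decRearr (P : Measure ℕ) : Antitone (decRearr P) := fun _ _ hjk =>
  sInf_le_sInf fun _ ht => le_trans (α := ℕ∞) ht (by exact_mod_cast hjk)

lemma tsum_eq_lintegral_encard_lt {α : Type*} {f : α → ℝ≥0∞} (hf : ∀ a, f a ≠ ∞) :
    ∑' a, f a = ∫⁻ t in Set.Ioi (0 : ℝ), ({a | ENNReal.ofReal t < f a}.encard : ℝ≥0∞) := by
  let _ : MeasurableSpace α := ⊤
  have hcake := lintegral_eq_lintegral_meas_lt Measure.count (f := fun a => (f a).toReal)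
    (ae_of_all _ fun _ => ENNReal.toReal_nonneg) (measurable_from_top).aemeasurable
  simp only [ENNReal.ofReal_toReal (hf _), lintegral_count,
    Measure.count_apply MeasurableSpace.measurableSet_top] at hcake
  rw [hcake]
  refine setLIntegral_congr_fun measurableSet_Ioi fun t ht => ?_
  simp only [ENNReal.ofReal_lt_iff_lt_toReal (le_of_lt ht) (hf _)]

lemma encard_setOf_natCast_lt (n : ℕ∞) : {k : ℕ | (k : ℕ∞) < n}.encard = n := by
  cases n with
  | top => simp
  | coe n => simpa using Set.Nat.encard_range n

lemma tsum_decRearr_tsub (P : Measure ℕ) [IsFiniteMeasure P] (c : ℝ≥0∞) :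
    ∑' k, (decRearr P k - c) = ∑' x, (P {x} - c) := by
  -- Both sides are the integral over `t` of the number of masses exceeding `t + c`.
  rw [tsum_eq_lintegral_encard_lt fun k => ENNReal.sub_ne_top (decRearr_ne_top P k),
    tsum_eq_lintegral_encard_lt fun x => ENNReal.sub_ne_top (measure_ne_top P _)]
  simp only [lt_tsub_iff_right, lt_decRearr_iff, encard_setOf_natCast_lt]

lemma sum_range_tsub_le_sum_range_tsub {a b : ℕ → ℝ≥0∞} (ha : Antitone a)
    (hab : ∀ n, ∑ i ∈ Finset.range n, a i ≤ ∑ i ∈ Finset.range n, b i) (c : ℝ≥0∞) (n : ℕ) :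
    ∑ i ∈ Finset.range n, (a i - c) ≤ ∑ i ∈ Finset.range n, (b i - c) := by
  rcases eq_or_ne c ∞ with rfl | hc
  · simp
  induction n with
  | zero => simp
  | succ n ih =>
    rcases le_total (a n) c with hn | hn
    · rw [Finset.sum_range_succ, tsub_eq_zero_of_le hn, add_zero]
      exact ih.trans (Finset.sum_le_sum_of_subset (Finset.range_mono n.le_succ))
    · have hac : ∀ i ∈ Finset.range (n + 1), a i - c + c = a i := fun i hi =>
        tsub_add_cancel_of_le (hn.trans (ha (Finset.mem_range_succ_iff.1 hi)))
      refine (ENNReal.add_le_add_iff_right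
        (ENNReal.sum_ne_top.2 fun _ _ => hc : ∑ _ ∈ Finset.range (n + 1), c ≠ ∞)).1 ?_
      rw [← Finset.sum_add_distrib, ← Finset.sum_add_distrib, Finset.sum_congr rfl hac]
      exact (hab (n + 1)).trans (Finset.sum_le_sum fun _ _ => le_tsub_add)

variable {P Q : Measure ℕ}

lemma Majorizes.tsum_tsub_le [IsFiniteMeasure P] [IsFiniteMeasure Q] (h : Majorizes Q P)
    (c : ℝ≥0∞) : ∑' x, (P {x} - c) ≤ ∑' x, (Q {x} - c) := by
  rw [← tsum_decRearr_tsub, ← tsum_decRearr_tsub]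
  exact ENNReal.tsum_le_of_sum_range_le fun n =>
    (sum_range_tsub_le_sum_range_tsub (antitone_decRearr P) h c n).trans (ENNReal.sum_le_tsum _)

lemma tsum_tsub_add_tsum_min {α : Type*} [Countable α] [MeasurableSpace α]
    [MeasurableSingletonClass α] (P : Measure α) (c : ℝ≥0∞) :
    ∑' x, (P {x} - c) + ∑' x, min (P {x}) c = P Set.univ := by
  simp only [← ENNReal.tsum_add, tsub_add_min, tsum_measure_singleton]

lemma Majorizes.tsum_min_le [IsProbabilityMeasure P] [IsProbabilityMeasure Q] (h : Majorizes Q P)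
    (c : ℝ≥0∞) : ∑' x, min (Q {x}) c ≤ ∑' x, min (P {x}) c := by
  have hP := tsum_tsub_add_tsum_min P c
  have hQ := tsum_tsub_add_tsum_min Q c
  rw [measure_univ] at hP hQ
  have hne : ∑' x, (P {x} - c) ≠ ∞ :=
    ne_top_of_le_ne_top ENNReal.one_ne_top (le_self_add.trans_eq hP)
  refine (ENNReal.add_le_add_iff_left hne).1 ?_
  calc ∑' x, (P {x} - c) + ∑' x, min (Q {x}) c
      ≤ ∑' x, (Q {x} - c) + ∑' x, min (Q {x}) c := add_le_add_left (h.tsum_tsub_le c) _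
    _ = ∑' x, (P {x} - c) + ∑' x, min (P {x}) c := by rw [hP, hQ]

lemma Majorizes.entropyTail_le [IsProbabilityMeasure P] [IsProbabilityMeasure Q]
    (h : Majorizes Q P) (M : ℝ) : entropyTail Q M ≤ entropyTail P M :=
  lintegral_mono fun _ => h.tsum_min_le _

end Majorization


/-! ### Fano's inequality for list decoding -/

section Fano

/-- The mixture, with weights `w` and `v`, of the distribution giving mass `L⁻¹` to each letter of
a list `A` and a distribution `r`. It is the reference distribution in the proof of Fano's
inequality for list decoding; `L` is the list size, which may exceed the length of `A`. -/
noncomputable def listMixture {α : Type*} [DecidableEq α] (A : Finset α) (L : ℕ) (w v : ℝ≥0∞)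
    (r : α → ℝ≥0∞) (x : α) : ℝ≥0∞ :=
  w * (if x ∈ A then (L : ℝ≥0∞)⁻¹ else 0) + v * r x

section ListMixture

variable {α : Type*} [DecidableEq α] {A : Finset α} {L : ℕ} {w v : ℝ≥0∞} {r : α → ℝ≥0∞} {x : α}

lemma tsum_listMixture_le_one (hA : A.card ≤ L) (hwv : w + v ≤ 1) (hr : ∑' x, r x ≤ 1) :
    ∑' x, listMixture A L w v r x ≤ 1 := by
  have hlist : ∑' x, (if x ∈ A then (L : ℝ≥0∞)⁻¹ else 0) ≤ 1 := by
    rw [tsum_eq_sum (s := A) fun x hx => if_neg hx, Finset.sum_congr rfl fun x hx => if_pos hx,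
      Finset.sum_const, nsmul_eq_mul]
    calc (A.card : ℝ≥0∞) * (L : ℝ≥0∞)⁻¹ ≤ L * (L : ℝ≥0∞)⁻¹ := by gcongr
      _ ≤ 1 := ENNReal.mul_inv_le_one _
  calc ∑' x, listMixture A L w v r x
      = w * ∑' x, (if x ∈ A then (L : ℝ≥0∞)⁻¹ else 0) + v * ∑' x, r x := by
        simp only [listMixture, ENNReal.tsum_add, ENNReal.tsum_mul_left]
    _ ≤ w * 1 + v * 1 := by gcongr
    _ ≤ 1 := by simpa using hwv

lemma selfInfo_listMixture_le_of_mem (hx : x ∈ A) :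
    selfInfo (listMixture A L w v r x) ≤ selfInfo w + ENNReal.ofReal (Real.log L) := by
  calc selfInfo (listMixture A L w v r x) ≤ selfInfo (w * (L : ℝ≥0∞)⁻¹) :=
        antitone_selfInfo (by rw [listMixture, if_pos hx]; exact le_self_add)
    _ ≤ selfInfo w + ENNReal.ofReal (Real.log L) := by
        rw [← selfInfo_natCast_inv]
        exact selfInfo_mul_le _ _

lemma selfInfo_listMixture_le :
    selfInfo (listMixture A L w v r x) ≤ selfInfo v + selfInfo (r x) :=
  (antitone_selfInfo le_add_self).trans (selfInfo_mul_le _ _)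

end ListMixture

variable {Ω β : Type*} [MeasurableSpace Ω] [MeasurableSpace β] {X : Ω → ℕ} {Y : Ω → β}
  {μ : Measure Ω} {L : ℕ} {w v M : ℝ≥0∞}

lemma ListDecoder.measurable_listMixture (f : ListDecoder β L) (w v : ℝ≥0∞) (r : ℕ → ℝ≥0∞) :
    Measurable fun z : β × ℕ => listMixture (f.toFun z.1) L w v r z.2 :=
  measurable_from_prod_countable_left fun x =>
    ((Measurable.ite (f.measurableSet_mem x) measurable_const measurable_const).const_mul
      w).add_const (v * r x)

lemma ListDecoder.measurableSet_error (f : ListDecoder β L) (hX : Measurable X)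
    (hY : Measurable Y) : MeasurableSet {ω | X ω ∉ f.toFun (Y ω)} := by
  have hmem : Measurable fun z : β × ℕ => z.2 ∈ f.toFun z.1 :=
    measurable_from_prod_countable_left fun x => measurable_mem.2 (f.measurableSet_mem x)
  exact (measurableSet_setOfPred.2 (hmem.comp (hY.prodMk hX))).compl

variable [IsProbabilityMeasure μ]

lemma ListDecoder.condShannonEntropy_le (f : ListDecoder β L) (hX : Measurable X)
    (hY : Measurable Y) (hwv : w + v ≤ 1) (M : ℝ≥0∞) :
    condShannonEntropy X Y μ ≤ selfInfo w + ENNReal.ofReal (Real.log L)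
      + ∑' x, μ.map X {x} * (selfInfo (μ.map X {x}) - M)
      + μ {ω | X ω ∉ f.toFun (Y ω)} * (selfInfo v + M) := by
  have := Measure.isProbabilityMeasure_map (μ := μ) hX.aemeasurable
  let r (x : ℕ) : ℝ≥0∞ := μ.map X {x}
  let E : Set Ω := {ω | X ω ∉ f.toFun (Y ω)}
  have hE : MeasurableSet E := f.measurableSet_error hX hY
  have hr : ∑' x, r x ≤ 1 := by rw [tsum_measure_singleton, measure_univ]
  have hpt (ω : Ω) : selfInfo (listMixture (f.toFun (Y ω)) L w v r (X ω))
      ≤ selfInfo w + ENNReal.ofReal (Real.log L) + (selfInfo (r (X ω)) - M)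
        + E.indicator (fun _ => selfInfo v + M) ω := by
    by_cases hω : ω ∈ E
    · rw [Set.indicator_of_mem hω]
      calc selfInfo (listMixture (f.toFun (Y ω)) L w v r (X ω))
          ≤ selfInfo v + (selfInfo (r (X ω)) - M + M) :=
            selfInfo_listMixture_le.trans (add_le_add_right le_tsub_add _)
        _ = selfInfo (r (X ω)) - M + (selfInfo v + M) := by ring
        _ ≤ _ := add_le_add_left le_add_self _
    · rw [Set.indicator_of_notMem hω, add_zero]
      exact (selfInfo_listMixture_le_of_mem (not_not.1 hω)).trans le_self_add
  calc condShannonEntropy X Y μ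
      ≤ ∫⁻ ω, selfInfo (listMixture (f.toFun (Y ω)) L w v r (X ω)) ∂μ :=
        condShannonEntropy_le_lintegral_selfInfo hX hY (f.measurable_listMixture w v r)
          fun y => tsum_listMixture_le_one (f.card_le y) hwv hr
    _ ≤ _ := lintegral_mono hpt
    _ = _ := by
        rw [lintegral_add_right _ (measurable_const.indicator hE), lintegral_add_left
          measurable_const, lintegral_const, measure_univ, mul_one, lintegral_indicator_const hE,
          lintegral_comp_eq_tsum hX fun x => selfInfo (r x) - M, mul_comm (selfInfo v + M)]

lemma condShannonEntropy_le_listError (hX : Measurable X) (hY : Measurable Y) (hwv : w + v ≤ 1)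
    (hv : v ≠ 0) (hM₀ : M ≠ 0) (hM : M ≠ ∞) (L : ℕ) :
    condShannonEntropy X Y μ ≤ selfInfo w + ENNReal.ofReal (Real.log L)
      + ∑' x, μ.map X {x} * (selfInfo (μ.map X {x}) - M)
      + listError L X Y μ * (selfInfo v + M) := by
  rw [listError, ENNReal.iInf_mul_of_ne (by simp [hM₀])
    (ENNReal.add_ne_top.2 ⟨selfInfo_ne_top hv, hM⟩), ENNReal.add_iInf]
  exact le_iInf fun f => f.condShannonEntropy_le hX hY hwv M

lemma exists_condShannonEntropy_le_of_majorizes {P : Measure ℕ} [IsProbabilityMeasure P]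
    (hP : shannonEntropy P < ∞) {ε : NNReal} (hε : 0 < ε) :
    ∃ C : ℝ≥0∞, C ≠ ∞ ∧ ∀ {Ω β : Type*} [MeasurableSpace Ω] [MeasurableSpace β] {μ : Measure Ω}
      [IsProbabilityMeasure μ] {X : Ω → ℕ} {Y : Ω → β}, Measurable X → Measurable Y →
      Majorizes (μ.map X) P → ∀ L : ℕ, condShannonEntropy X Y μ
        ≤ ENNReal.ofReal (Real.log L) + ε + listError L X Y μ * C := by
  let η : ℝ := ε / 2
  have hη : 0 < η := half_pos (NNReal.coe_pos.2 hε)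
  have hηε : ENNReal.ofReal η + ENNReal.ofReal η = ε := by
    rw [← ENNReal.ofReal_add hη.le hη.le, add_halves, ENNReal.ofReal_coe_nnreal]
  obtain ⟨M, hPM, hM⟩ := (((tendsto_entropyTail hP).eventually_lt_const
    (ENNReal.ofReal_pos.2 hη)).and (eventually_gt_atTop 0)).exists
  let w : ℝ≥0∞ := ENNReal.ofReal (Real.exp (-η))
  have hw : w < 1 := by simpa [w] using hη
  have hv : 1 - w ≠ 0 := (tsub_pos_of_lt hw).ne'
  refine ⟨selfInfo (1 - w) + ENNReal.ofReal M,
    ENNReal.add_ne_top.2 ⟨selfInfo_ne_top hv, ENNReal.ofReal_ne_top⟩,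
    fun {Ω β} _ _ {μ} _ {X Y} hX hY hmaj L => ?_⟩
  have := Measure.isProbabilityMeasure_map (μ := μ) hX.aemeasurable
  have htail : ∑' x, μ.map X {x} * (selfInfo (μ.map X {x}) - ENNReal.ofReal M)
      ≤ ENNReal.ofReal η :=
    (tsum_mul_selfInfo_tsub_le_entropyTail _ hM.le).trans ((hmaj.entropyTail_le M).trans hPM.le)
  refine (condShannonEntropy_le_listError hX hY (add_tsub_cancel_of_le hw.le).le hv
    (ENNReal.ofReal_pos.2 hM).ne' ENNReal.ofReal_ne_top L).trans (add_le_add_left ?_ _)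
  calc selfInfo w + ENNReal.ofReal (Real.log L)
        + ∑' x, μ.map X {x} * (selfInfo (μ.map X {x}) - ENNReal.ofReal M)
      ≤ ENNReal.ofReal η + ENNReal.ofReal (Real.log L) + ENNReal.ofReal η := by
        rw [selfInfo_ofReal_exp_neg]
        gcongr
    _ = ENNReal.ofReal (Real.log L) + ε := by
        rw [← hηε]
        ring

end Fano

section Block

variable {Ω : Type*} [MeasurableSpace Ω] {μ : Measure Ω} [IsProbabilityMeasure μ]
  {𝒴 : ℕ → Type*} [∀ i, MeasurableSpace (𝒴 i)] {X : ℕ → Ω → ℕ} {Y : (i : ℕ) → Ω → 𝒴 i}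

lemma condShannonEntropy_block_le_sum (hX : ∀ i, Measurable (X i)) (hY : ∀ i, Measurable (Y i))
    (n : ℕ) : condShannonEntropy (block X n) (block Y n) μ
      ≤ ∑ i ∈ Finset.range n, condShannonEntropy (X i) (Y i) μ := by
  rw [← Fin.sum_univ_eq_sum_range fun i => condShannonEntropy (X i) (Y i) μ]
  exact condShannonEntropy_pi_le_sum (fun i : Fin n => hX i) fun i => hY i

lemma condShannonEntropy_block_div_le (hX : ∀ i, Measurable (X i)) (hY : ∀ i, Measurable (Y i))
    {L : ℕ → ℕ} {N n : ℕ} {c C : ℝ≥0∞}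
    (h : ∀ i, N ≤ i → condShannonEntropy (X i) (Y i) μ ≤ c + listError (L n) (X i) (Y i) μ * C) :
    condShannonEntropy (block X n) (block Y n) μ / n
      ≤ c + ((∑ i ∈ Finset.range N, shannonEntropy (μ.map (X i))) / n
        + symbolwiseListError L X Y μ n * C) := by
  set A := ∑ i ∈ Finset.range N, shannonEntropy (μ.map (X i))
  set S := ∑ i ∈ Finset.range n, listError (L n) (X i) (Y i) μ
  have hletter (i : ℕ) : condShannonEntropy (X i) (Y i) μ
      ≤ (if i < N then shannonEntropy (μ.map (X i)) else 0)
        + (c + listError (L n) (X i) (Y i) μ * C) := by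
    split_ifs with hi
    · exact (condShannonEntropy_le_shannonEntropy (hX i) (hY i)).trans le_self_add
    · exact (h i (not_lt.1 hi)).trans le_add_self
  have hinitial :
      ∑ i ∈ Finset.range n, (if i < N then shannonEntropy (μ.map (X i)) else 0) ≤ A := by
    rw [← Finset.sum_filter]
    exact Finset.sum_le_sum_of_subset fun i hi => Finset.mem_range.2 (Finset.mem_filter.1 hi).2
  have hblock : condShannonEntropy (block X n) (block Y n) μ ≤ A + (n * c + S * C) := by
    refine (condShannonEntropy_block_le_sum hX hY n).trans
      ((Finset.sum_le_sum fun i _ => hletter i).trans ?_)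
    rw [Finset.sum_add_distrib, Finset.sum_add_distrib, Finset.sum_const, Finset.card_range,
      nsmul_eq_mul, Finset.sum_mul]
    exact add_le_add_left hinitial _
  calc condShannonEntropy (block X n) (block Y n) μ / n
      ≤ (A + (n * c + S * C)) / n := by gcongr
    _ = n / n * c + (A / n + S / n * C) := by
        simp only [div_eq_mul_inv]
        ring
    _ ≤ c + (A / n + S / n * C) :=
        add_le_add_left (mul_le_of_le_one_left' ENNReal.div_self_le_one) _

end Block

lemma limsup_add_le_of_tendsto {ι : Type*} {f : Filter ι} [f.NeBot] {u v : ι → ℝ≥0∞} {b : ℝ≥0∞}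
    (hv : Tendsto v f (𝓝 b)) : limsup (fun i => u i + v i) f ≤ limsup u f + b := by
  refine ENNReal.le_of_forall_pos_le_add fun ε hε hlt => ?_
  have hb : b < b + ε :=
    ENNReal.lt_add_right (ENNReal.add_lt_top.1 hlt).2.ne (ENNReal.coe_ne_zero.2 hε.ne')
  calc limsup (fun i => u i + v i) f ≤ limsup (fun i => u i + (b + ε)) f :=
        limsup_le_limsup ((hv.eventually_lt_const hb).mono fun i hi => add_le_add_right hi.le (u i))
    _ = limsup u f + b + ε := by
        rw [limsup_add_const f u (b + ε) (by isBoundedDefault) (by isBoundedDefault), add_assoc]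

theorem theorem5 {Ω : Type*} [MeasurableSpace Ω] (μ : Measure Ω) [IsProbabilityMeasure μ]
    {𝒴 : ℕ → Type*} [∀ i, MeasurableSpace (𝒴 i)]
    (X : ℕ → Ω → ℕ) (hX : ∀ i, Measurable (X i))
    (Y : (i : ℕ) → Ω → 𝒴 i) (hY : ∀ i, Measurable (Y i))
    (hHX : ∀ i, shannonEntropy (μ.map (X i)) < ∞)
    (L : ℕ → ℕ) (hL : ∀ n, 1 ≤ n → 1 ≤ L n)
    (P : Measure ℕ) [IsProbabilityMeasure P] (hHP : shannonEntropy P < ∞)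
    (hmaj : ∀ᶠ i in atTop, Majorizes (μ.map (X i)) P)
    (herr : Tendsto (fun n => symbolwiseListError L X Y μ n) atTop (𝓝 0)) :
    limsup (fun n : ℕ => condShannonEntropy (block X n) (block Y n) μ / (n : ℝ≥0∞)) atTop
      ≤ limsup (fun n : ℕ => ENNReal.ofReal (Real.log (L n))) atTop := by
  refine ENNReal.le_of_forall_pos_le_add fun ε hε _ => ?_
  obtain ⟨C, hC, hfano⟩ := exists_condShannonEntropy_le_of_majorizes hHP hε
  obtain ⟨N, hN⟩ := eventually_atTop.1 hmaj
  set A := ∑ i ∈ Finset.range N, shannonEntropy (μ.map (X i))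
  have hA : Tendsto (fun n : ℕ => A / n) atTop (𝓝 0) := by
    simpa using ENNReal.Tendsto.const_div ENNReal.tendsto_nat_nhds_top
      (Or.inr (ENNReal.sum_ne_top.2 fun i _ => (hHX i).ne : A ≠ ∞))
  have herrC : Tendsto (fun n => symbolwiseListError L X Y μ n * C) atTop (𝓝 0) := by
    simpa using ENNReal.Tendsto.mul_const herr (Or.inr hC)
  have hbound (n : ℕ) : condShannonEntropy (block X n) (block Y n) μ / n
      ≤ ENNReal.ofReal (Real.log (L n)) + (ε + (A / n + symbolwiseListError L X Y μ n * C)) := by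
    rw [← add_assoc]
    exact condShannonEntropy_block_div_le hX hY fun i hi => hfano (hX i) (hY i) (hN i hi) (L n)
  have hlim : Tendsto (fun n : ℕ => ε + (A / n + symbolwiseListError L X Y μ n * C)) atTop
      (𝓝 ε) := by
    simpa using (hA.add herrC).const_add (ε : ℝ≥0∞)
  exact (limsup_le_limsup (.of_forall hbound)).trans (limsup_add_le_of_tendsto hlim)
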